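/- Let $B\in\mathbb C^{n\times n}$, and let $B^*$ denote its conjugate transpose. The following are equivalent. (i) For every $t\in[0,2\pi)$, $e^{it}B$ is unitarily similar to $B$, that is, $Ue^{it}BU^*=B$ for some unitary matrix $U$ (depending on $t$). (ii) $\mathrm{Tr}\,w(B,B^*)=0$ for every word $w$ in two formal letters $P,Q$ in which the number of occurrences of $P$ differs from the number of occurrences of $Q$; here $w(B,B^*)$ is the matrix product obtained from $w$ by putting $B$ for $P$ and $B^*$ for $Q$. (iii) There is a matrix $K\in\mathbb C^{n\times n}$ with $K^*=-K$ and $KB-BK=-iB$. (iv) There is a unitary matrix $U$ such that $UBU^*=B_1\oplus\dots\oplus B_r$ is block diagonal and each $B_j$ can be partitioned into blocks, with square blocks on the block diagonal, in such a way that its only nonzero blocks are on the block superdiagonal (that is, the block in position $(k,l)$ is zero unless $l=k+1$). -/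

import Mathlib

open Matrix

/-- Square complex matrices `A`, `B` are unitarily similar: `U A U* = B` for some unitary `U`. -/
def UnitarilySimilar {n : ℕ} (A B : Matrix (Fin n) (Fin n) ℂ) : Prop :=
  ∃ U ∈ Matrix.unitaryGroup (Fin n) ℂ, U * A * Uᴴ = B

/-- The two formal letters out of which words are formed. -/
inductive Letter
  | P
  | Q
  deriving DecidableEq

/-- The matrix that a letter stands for when `X` is put for `P` and `Y` for `Q`. -/
def Letter.eval {n : ℕ} (X Y : Matrix (Fin n) (Fin n) ℂ) : Letter → Matrix (Fin n) (Fin n) ℂ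
  | Letter.P => X
  | Letter.Q => Y

/-- The value `w(X, Y)` of a word `w`: the product of its letters, from left to right. -/
def wordEval {n : ℕ} (w : List Letter) (X Y : Matrix (Fin n) (Fin n) ℂ) :
    Matrix (Fin n) (Fin n) ℂ :=
  (w.map (Letter.eval X Y)).prod

/-- A matrix partitioned into `p × p` blocks, block `(k, l)` having size `s k × s l` (so that the
diagonal blocks are square), all of whose nonzero blocks lie on the block superdiagonal
`l = k + 1`. The index `⟨k, a⟩` is position `a` inside the `k`-th part. -/
def IsBlockSuperdiagonal {p : ℕ} {s : Fin p → ℕ}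
    (M : Matrix (Σ k : Fin p, Fin (s k)) (Σ k : Fin p, Fin (s k)) ℂ) : Prop :=
  ∀ (k l : Fin p), (l : ℕ) ≠ (k : ℕ) + 1 →
    ∀ (a : Fin (s k)) (b : Fin (s l)), M ⟨k, a⟩ ⟨l, b⟩ = 0

/-- The consecutive enumeration by `0, …, n - 1` of the rows of a direct sum of `r` matrices, the
`j`-th of which is partitioned into parts of sizes `s j 0, s j 1, …`: summands in order, inside
each summand the parts in order, inside each part the positions in order. -/
def rowPosition {n r : ℕ} {p : Fin r → ℕ} (s : (j : Fin r) → Fin (p j) → ℕ)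
    (h : ∑ j, ∑ k, s j k = n) :
    (Σ j : Fin r, Σ k : Fin (p j), Fin (s j k)) ≃ Fin n :=
  (Equiv.sigmaCongrRight fun j => finSigmaFinEquiv (n := s j)).trans
    ((finSigmaFinEquiv (n := fun j => ∑ k, s j k)).trans (finCongr h))

/-- `M = B₁ ⊕ ⋯ ⊕ B_r` is block diagonal, each `B_j` being a nonempty matrix partitioned into
nonempty blocks whose only nonzero blocks are on the block superdiagonal. -/
def IsDirectSumOfBlockSuperdiagonal {n : ℕ} (M : Matrix (Fin n) (Fin n) ℂ) : Prop :=
  ∃ (r : ℕ) (p : Fin r → ℕ) (s : (j : Fin r) → Fin (p j) → ℕ)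
    (h : ∑ j, ∑ k, s j k = n)
    (C : (j : Fin r) → Matrix (Σ k : Fin (p j), Fin (s j k)) (Σ k : Fin (p j), Fin (s j k)) ℂ),
    (∀ j, 0 < p j) ∧ (∀ j k, 0 < s j k) ∧ (∀ j, IsBlockSuperdiagonal (C j)) ∧
      M = Matrix.reindex (rowPosition s h) (rowPosition s h) (Matrix.blockDiagonal' C)

/-! The implications run in the cycle (i) → (ii) → (iii) → (iv) → (i); the hard one is (ii) → (iii).
Give a word the degree #P − #Q. By (ii) the spans `wordSpan B d` are mutually orthogonal for the
Frobenius product, so only finitely many are nonzero. Right multiplication by `B` raises the degree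
by one and its adjoint, right multiplication by `Bᴴ`, lowers it; hence the orthogonal projections
satisfy P_{d+1}(xB) = P_d(x)B. Right multiplication acts on column indices only, so a partial trace
over rows turns P_d into a positive semidefinite matrix c_d with c_d B = B c_{d+1}. Then C = ∑ c_d
commutes with B and is positive definite because 1 has degree 0, while H = ∑ d c_d satisfies HB − BH
= −BC. So −C⁻¹H has commutator B with B, and −i times its Hermitian part is K. An eigenbasis of iK
grades B by real numbers, whose floors give an integer grading; sorting by degree gives (iv).
Conversely, a grading provides diagonal unitaries that rotate B, and rotation by t multiplies Tr
w(B, B*) by e^{it deg w}. -/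

/-! ### Frobenius orthogonality -/

open scoped ComplexOrder in
theorem Matrix.finite_ne_bot_of_trace_orthogonal {n : ℕ} {ι : Type*}
    (W : ι → Submodule ℂ (Matrix (Fin n) (Fin n) ℂ))
    (hW : ∀ i j, i ≠ j → ∀ x ∈ W i, ∀ y ∈ W j, (x * yᴴ).trace = 0) :
    {i | W i ≠ ⊥}.Finite := by
  let := Matrix.toMatrixNormedAddCommGroup (1 : Matrix (Fin n) (Fin n) ℂ) Matrix.PosDef.one
  let := Matrix.toMatrixInnerProductSpace (1 : Matrix (Fin n) (Fin n) ℂ) Matrix.PosSemidef.one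
  apply WellFoundedGT.finite_ne_bot_of_iSupIndep
  have : OrthogonalFamily ℂ (fun i => W i) fun i => (W i).subtypeₗᵢ := by
    intro i j hij x y
    change ((y : Matrix (Fin n) (Fin n) ℂ) * 1 * (x : Matrix (Fin n) (Fin n) ℂ)ᴴ).trace = 0
    rw [mul_one]
    exact hW j i hij.symm _ y.2 _ x.2
  exact this.independent

open scoped ComplexOrder in
theorem Matrix.exists_trace_projection {n : ℕ}
    (W : Submodule ℂ (Matrix (Fin n) (Fin n) ℂ)) :
    ∃ P : Matrix (Fin n) (Fin n) ℂ →ₗ[ℂ] Matrix (Fin n) (Fin n) ℂ,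
      (∀ x, P x ∈ W) ∧ ∀ x, ∀ y ∈ W, ((x - P x) * yᴴ).trace = 0 := by
  let := Matrix.toMatrixNormedAddCommGroup (1 : Matrix (Fin n) (Fin n) ℂ) Matrix.PosDef.one
  let := Matrix.toMatrixInnerProductSpace (1 : Matrix (Fin n) (Fin n) ℂ) Matrix.PosSemidef.one
  refine ⟨W.starProjection, fun x => W.starProjection_apply_mem x, fun x y hy => ?_⟩
  have h := Submodule.starProjection_inner_eq_zero (K := W) x y hy
  rw [← inner_conj_symm, map_eq_zero] at h
  rw [← mul_one (x - _)]
  exact h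

/-! ### Words graded by degree -/

/-- The degree of a word: the number of letters `P` minus the number of letters `Q`. -/
def wordDegree (w : List Letter) : ℤ := (w.count Letter.P : ℤ) - w.count Letter.Q

/-- The span of the values at `(B, Bᴴ)` of the words of degree `d`. -/
def wordSpan {n : ℕ} (B : Matrix (Fin n) (Fin n) ℂ) (d : ℤ) :
    Submodule ℂ (Matrix (Fin n) (Fin n) ℂ) :=
  Submodule.span ℂ {x | ∃ w, wordDegree w = d ∧ x = wordEval w B Bᴴ}

/-- The word obtained by reversing and exchanging the two letters. -/
def wordAdjoint (w : List Letter) : List Letter :=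
  (w.map fun a => match a with | Letter.P => Letter.Q | Letter.Q => Letter.P).reverse

theorem wordEval_append {n : ℕ} (v w : List Letter) (X Y : Matrix (Fin n) (Fin n) ℂ) :
    wordEval (v ++ w) X Y = wordEval v X Y * wordEval w X Y := by
  simp [wordEval]

theorem wordDegree_append (v w : List Letter) :
    wordDegree (v ++ w) = wordDegree v + wordDegree w := by
  simp [wordDegree]; ring

theorem wordEval_cons {n : ℕ} (a : Letter) (w : List Letter) (X Y : Matrix (Fin n) (Fin n) ℂ) :
    wordEval (a :: w) X Y = a.eval X Y * wordEval w X Y := by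
  simp [wordEval]

theorem wordDegree_adjoint (w : List Letter) : wordDegree (wordAdjoint w) = -wordDegree w := by
  induction w with
  | nil => rfl
  | cons a w ih =>
    cases a <;> simp [wordAdjoint, wordDegree] at ih ⊢ <;> linarith

theorem wordEval_adjoint {n : ℕ} (w : List Letter) (B : Matrix (Fin n) (Fin n) ℂ) :
    wordEval (wordAdjoint w) B Bᴴ = (wordEval w B Bᴴ)ᴴ := by
  induction w with
  | nil => simp [wordAdjoint, wordEval]
  | cons a w ih =>
    have h : wordAdjoint (a :: w) = wordAdjoint w ++ wordAdjoint [a] := by simp [wordAdjoint]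
    rw [h, wordEval_append, ih, wordEval_cons, conjTranspose_mul]
    cases a <;> simp [wordAdjoint, wordEval, Letter.eval]

theorem wordSpan_mul_mem {n : ℕ} (B : Matrix (Fin n) (Fin n) ℂ) {d : ℤ} (v : List Letter)
    {x : Matrix (Fin n) (Fin n) ℂ} (hx : x ∈ wordSpan B d) :
    x * wordEval v B Bᴴ ∈ wordSpan B (d + wordDegree v) := by
  induction hx using Submodule.span_induction with
  | mem x h =>
    obtain ⟨w, rfl, rfl⟩ := h
    exact Submodule.subset_span ⟨w ++ v, wordDegree_append w v, (wordEval_append _ _ _ _).symm⟩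
  | zero => simp
  | add x y _ _ hx hy => rw [add_mul]; exact add_mem hx hy
  | smul a x _ hx => rw [smul_mul]; exact Submodule.smul_mem _ _ hx

theorem wordSpan_mul_self_mem {n : ℕ} (B : Matrix (Fin n) (Fin n) ℂ) {d : ℤ}
    {x : Matrix (Fin n) (Fin n) ℂ} (hx : x ∈ wordSpan B d) : x * B ∈ wordSpan B (d + 1) := by
  simpa [wordEval, Letter.eval, wordDegree] using wordSpan_mul_mem B [Letter.P] hx

theorem wordSpan_mul_conjTranspose_mem {n : ℕ} (B : Matrix (Fin n) (Fin n) ℂ) {d : ℤ}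
    {x : Matrix (Fin n) (Fin n) ℂ} (hx : x ∈ wordSpan B (d + 1)) : x * Bᴴ ∈ wordSpan B d := by
  simpa [wordEval, Letter.eval, wordDegree] using wordSpan_mul_mem B [Letter.Q] hx

theorem one_mem_wordSpan {n : ℕ} (B : Matrix (Fin n) (Fin n) ℂ) : 1 ∈ wordSpan B 0 :=
  Submodule.subset_span ⟨[], rfl, rfl⟩

/-- For words, `x * yᴴ` is again the value of a word, of degree `d - e ≠ 0`; sesquilinearity does
the rest. -/
theorem trace_mul_conjTranspose_of_mem_wordSpan {n : ℕ} (B : Matrix (Fin n) (Fin n) ℂ)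
    (h : ∀ w : List Letter, w.count Letter.P ≠ w.count Letter.Q → (wordEval w B Bᴴ).trace = 0)
    {d e : ℤ} (hde : d ≠ e) {x y : Matrix (Fin n) (Fin n) ℂ}
    (hx : x ∈ wordSpan B d) (hy : y ∈ wordSpan B e) : (x * yᴴ).trace = 0 := by
  induction hx, hy using Submodule.span_induction₂ with
  | mem_mem x y hx hy =>
    obtain ⟨v, rfl, rfl⟩ := hx
    obtain ⟨w, rfl, rfl⟩ := hy
    rw [← wordEval_adjoint, ← wordEval_append]
    apply h
    have := wordDegree_append v (wordAdjoint w)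
    rw [wordDegree_adjoint] at this
    intro hc
    rw [wordDegree, hc] at this
    apply hde
    linarith
  | zero_left y hy => simp
  | zero_right x hx => simp
  | add_left x y z _ _ _ h1 h2 => simp [add_mul, h1, h2]
  | add_right x y z _ _ _ h1 h2 => simp [mul_add, h1, h2]
  | smul_left r x y _ _ h1 => simp [h1]
  | smul_right r x y _ _ h1 => simp [h1]

/-! ### Partial traces of projections -/

/-- For a linear map `P` on matrices, the compression of `P` to the single rows, summed over the
row index. -/
def rowCompression {n : ℕ} (P : Matrix (Fin n) (Fin n) ℂ →ₗ[ℂ] Matrix (Fin n) (Fin n) ℂ) :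
    Matrix (Fin n) (Fin n) ℂ :=
  Matrix.of fun k l => ∑ m, P (Matrix.single m k 1) m l

/-- Right multiplication by `B` preserves each row: `single m k 1 * B` is the combination of the
`single m q 1` with coefficients `B k q`. -/
theorem rowCompression_mul {n : ℕ}
    {P P' : Matrix (Fin n) (Fin n) ℂ →ₗ[ℂ] Matrix (Fin n) (Fin n) ℂ}
    {B : Matrix (Fin n) (Fin n) ℂ} (h : ∀ x, P' (x * B) = P x * B) :
    rowCompression P * B = B * rowCompression P' := by
  ext k l
  have h1 : ∀ m, Matrix.single m k 1 * B = ∑ q, B k q • Matrix.single m q (1 : ℂ) := by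
    intro m
    ext i j
    rw [Matrix.sum_apply]
    by_cases hi : m = i
    · subst hi
      simp [Matrix.single_apply]
    · simp [hi, mul_apply]
  have h2 : ∀ m, (P (Matrix.single m k 1) * B) m l
      = ∑ q, B k q * P' (Matrix.single m q 1) m l := by
    intro m
    rw [← h, h1, map_sum, Matrix.sum_apply]
    simp only [map_smul, Matrix.smul_apply, smul_eq_mul]
  simp only [mul_apply, rowCompression, of_apply, Finset.mul_sum, Finset.sum_mul] at h2 ⊢
  rw [Finset.sum_comm]
  simp only [h2]
  rw [Finset.sum_comm]

theorem rowCompression_zero {n : ℕ} :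
    rowCompression (0 : Matrix (Fin n) (Fin n) ℂ →ₗ[ℂ] Matrix (Fin n) (Fin n) ℂ) = 0 := by
  ext k l
  simp [rowCompression]

theorem trace_single_mul_conjTranspose {n : ℕ} (m k : Fin n) (y : Matrix (Fin n) (Fin n) ℂ) :
    (Matrix.single m k 1 * yᴴ).trace = star (y m k) := by
  simp [Matrix.trace_single_mul]

/-- `P` is the orthogonal projection onto `W` for the Frobenius inner product. -/
structure IsTraceProjection {n : ℕ} (W : Submodule ℂ (Matrix (Fin n) (Fin n) ℂ))
    (P : Matrix (Fin n) (Fin n) ℂ →ₗ[ℂ] Matrix (Fin n) (Fin n) ℂ) : Prop where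
  mem : ∀ x, P x ∈ W
  trace_eq : ∀ x, ∀ y ∈ W, (x * yᴴ).trace = (P x * yᴴ).trace

namespace IsTraceProjection

variable {n : ℕ} {W W' : Submodule ℂ (Matrix (Fin n) (Fin n) ℂ)}
  {P P' : Matrix (Fin n) (Fin n) ℂ →ₗ[ℂ] Matrix (Fin n) (Fin n) ℂ}

open scoped ComplexOrder in
theorem eq_of_mem (hP : IsTraceProjection W P) {x y : Matrix (Fin n) (Fin n) ℂ} (hy : y ∈ W)
    (h : ∀ z ∈ W, (x * zᴴ).trace = (y * zᴴ).trace) : P x = y := by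
  have hm : P x - y ∈ W := sub_mem (hP.mem x) hy
  have : ((P x - y) * (P x - y)ᴴ).trace = 0 := by
    rw [sub_mul, trace_sub, ← hP.trace_eq x _ hm, h _ hm, sub_self]
  exact sub_eq_zero.1 (Matrix.trace_mul_conjTranspose_self_eq_zero_iff.1 this)

theorem map_mul (hP : IsTraceProjection W P) (hP' : IsTraceProjection W' P')
    {B : Matrix (Fin n) (Fin n) ℂ} (h : ∀ x ∈ W, x * B ∈ W') (h' : ∀ x ∈ W', x * Bᴴ ∈ W)
    (x : Matrix (Fin n) (Fin n) ℂ) : P' (x * B) = P x * B := by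
  refine hP'.eq_of_mem (h _ (hP.mem x)) fun z hz => ?_
  have := hP.trace_eq x _ (h' z hz)
  simpa [conjTranspose_mul, mul_assoc] using this

theorem star_apply (hP : IsTraceProjection W P) (x : Matrix (Fin n) (Fin n) ℂ) (m k : Fin n) :
    star (P x m k) = (P (Matrix.single m k 1) * (P x)ᴴ).trace := by
  rw [← trace_single_mul_conjTranspose, hP.trace_eq _ _ (hP.mem x)]

theorem rowCompression_apply (hP : IsTraceProjection W P) (k l : Fin n) :
    rowCompression P k l
      = ∑ m, (P (Matrix.single m k 1) * (P (Matrix.single m l 1))ᴴ).trace := by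
  simp only [rowCompression, of_apply]
  refine Finset.sum_congr rfl fun m _ => ?_
  rw [← star_star (P (Matrix.single m k 1) m l), hP.star_apply, ← trace_conjTranspose]
  simp

/-- The sum on the right is ∑ ‖P(e_m x*)‖² in the Frobenius norm, which makes positivity visible. -/
theorem dotProduct_rowCompression (hP : IsTraceProjection W P) (x : Fin n → ℂ) :
    star x ⬝ᵥ (rowCompression P *ᵥ x)
      = ∑ m, (P (∑ k, star (x k) • Matrix.single m k 1) *
          (P (∑ k, star (x k) • Matrix.single m k 1))ᴴ).trace := by
  have h : ∀ m, (P (∑ k, star (x k) • Matrix.single m k 1) *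
      (P (∑ k, star (x k) • Matrix.single m k 1))ᴴ).trace = ∑ k, ∑ l, star (x k) *
        ((P (Matrix.single m k 1) * (P (Matrix.single m l 1))ᴴ).trace * x l) := by
    intro m
    simp only [map_sum, map_smul, conjTranspose_sum, Finset.sum_mul_sum, trace_sum,
      conjTranspose_smul, star_star, smul_mul, Matrix.mul_smul, trace_smul, smul_eq_mul]
    exact Finset.sum_congr rfl fun k _ => Finset.sum_congr rfl fun l _ => by ring
  simp only [dotProduct, mulVec, hP.rowCompression_apply, h, Finset.mul_sum, Finset.sum_mul,
    Pi.star_apply]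
  rw [Finset.sum_comm]
  rw [Finset.sum_comm (s := Finset.univ) (t := Finset.univ) (f := fun m k => ∑ l, star (x k) *
        ((P (Matrix.single m k 1) * (P (Matrix.single m l 1))ᴴ).trace * x l))]
  rw [Finset.sum_comm]
  exact Finset.sum_congr rfl fun k _ => Finset.sum_comm

theorem isHermitian_rowCompression (hP : IsTraceProjection W P) :
    (rowCompression P).IsHermitian := by
  ext k l
  rw [conjTranspose_apply, hP.rowCompression_apply, hP.rowCompression_apply, star_sum]
  refine Finset.sum_congr rfl fun m _ => ?_
  rw [← trace_conjTranspose]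
  simp

open scoped ComplexOrder in
theorem posSemidef_rowCompression (hP : IsTraceProjection W P) :
    (rowCompression P).PosSemidef := by
  refine .of_dotProduct_mulVec_nonneg hP.isHermitian_rowCompression fun x => ?_
  rw [hP.dotProduct_rowCompression]
  exact Finset.sum_nonneg fun m _ => (posSemidef_self_mul_conjTranspose _).trace_nonneg

open scoped ComplexOrder in
theorem posDef_rowCompression (hP : IsTraceProjection W P) (h1 : 1 ∈ W) :
    (rowCompression P).PosDef := by
  refine .of_dotProduct_mulVec_pos hP.isHermitian_rowCompression fun x hx => ?_
  rw [hP.dotProduct_rowCompression]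
  have h0 : ∀ m, 0 ≤ (P (∑ k, star (x k) • Matrix.single m k 1) *
          (P (∑ k, star (x k) • Matrix.single m k 1))ᴴ).trace :=
    fun m => (posSemidef_self_mul_conjTranspose _).trace_nonneg
  refine lt_of_le_of_ne (Finset.sum_nonneg fun m _ => h0 m) fun h => hx ?_
  ext m
  have h2 := (Finset.sum_eq_zero_iff_of_nonneg fun m _ => h0 m).1 h.symm m (Finset.mem_univ m)
  rw [Matrix.trace_mul_conjTranspose_self_eq_zero_iff] at h2
  -- Pairing e_m x* with 1 reads off the entry `star (x m)`.
  have h3 := hP.trace_eq (∑ k, star (x k) • Matrix.single m k 1) 1 h1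
  rw [h2] at h3
  simpa [-smul_single, trace_sum, trace_smul, trace, single_apply, Matrix.sum_apply,
    ite_and] using h3

end IsTraceProjection

/-! ### From vanishing traces to a commutator relation -/

open scoped ComplexOrder in
theorem exists_commutator_eq_of_trace_wordEval_eq_zero {n : ℕ} (B : Matrix (Fin n) (Fin n) ℂ)
    (h : ∀ w : List Letter, w.count Letter.P ≠ w.count Letter.Q →
      (wordEval w B Bᴴ).trace = 0) :
    ∃ H : Matrix (Fin n) (Fin n) ℂ, H * B - B * H = B ∧ H * Bᴴ - Bᴴ * H = -Bᴴ := by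
  have hfin := Matrix.finite_ne_bot_of_trace_orthogonal (wordSpan B)
    fun i j hij x hx y hy => trace_mul_conjTranspose_of_mem_wordSpan B h hij hx hy
  choose P hPm hPt using fun d => Matrix.exists_trace_projection (wordSpan B d)
  have hP : ∀ d, IsTraceProjection (wordSpan B d) (P d) := fun d =>
    ⟨hPm d, fun x y hy => by simpa [sub_mul, sub_eq_zero] using hPt d x y hy⟩
  set c : ℤ → Matrix (Fin n) (Fin n) ℂ := fun d => rowCompression (P d) with hc
  have hcB : ∀ d, c d * B = B * c (d + 1) := fun d => rowCompression_mul
    ((hP d).map_mul (hP (d + 1)) (fun x hx => wordSpan_mul_self_mem B hx)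
      fun x hx => wordSpan_mul_conjTranspose_mem B hx)
  have hsupp : (Function.support c).Finite := by
    refine hfin.subset fun d hd hbot => hd ?_
    have : P d = 0 := by
      ext1 x
      simpa [hbot] using hPm d x
    simp [hc, this, rowCompression_zero]
  obtain ⟨N, hN⟩ : ∃ N : ℕ, ∀ d, c d ≠ 0 → -(N : ℤ) ≤ d ∧ d ≤ N := by
    obtain ⟨N, hN⟩ := (hsupp.image Int.natAbs).bddAbove
    refine ⟨N, fun d hd => ?_⟩
    have := hN ⟨d, hd, rfl⟩
    omega
  -- The margin of one is for the shift: `c (d + 1)` may be nonzero at `d = -N - 1`.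
  set T := Finset.Icc (-(N : ℤ) - 1) (N + 1) with hT
  have hshift : ∀ f : ℤ → ℂ, ∑ d ∈ T, f d • c (d + 1) = ∑ d ∈ T, f (d - 1) • c d := by
    intro f
    have e1 : ∑ d ∈ T, f d • c (d + 1) = ∑ᶠ d, f d • c (d + 1) := by
      refine (finsum_eq_sum_of_support_subset _ fun d hd => ?_).symm
      have := hN (d + 1) fun h0 => hd (by simp [h0])
      simp only [hT, Finset.coe_Icc, Set.mem_Icc]
      omega
    have e2 : ∑ d ∈ T, f (d - 1) • c d = ∑ᶠ d, f (d - 1) • c d := by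
      refine (finsum_eq_sum_of_support_subset _ fun d hd => ?_).symm
      have := hN d fun h0 => hd (by simp [h0])
      simp only [hT, Finset.coe_Icc, Set.mem_Icc]
      omega
    rw [e1, e2, ← finsum_comp_equiv (f := fun d => f (d - 1) • c d) (Equiv.addRight (1 : ℤ))]
    simp
  have hmul : ∀ f : ℤ → ℂ, (∑ d ∈ T, f d • c d) * B = B * ∑ d ∈ T, f (d - 1) • c d := by
    intro f
    rw [← hshift, Finset.sum_mul, Finset.mul_sum]
    simp [hcB]
  have hherm : ∀ f : ℤ → ℝ, (∑ d ∈ T, (f d : ℂ) • c d)ᴴ = ∑ d ∈ T, (f d : ℂ) • c d := by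
    intro f
    rw [conjTranspose_sum]
    refine Finset.sum_congr rfl fun d _ => ?_
    rw [conjTranspose_smul, (hP d).isHermitian_rowCompression.eq]
    simp [hc]
  set C := ∑ d ∈ T, c d with hC
  set H := ∑ d ∈ T, ((d : ℝ) : ℂ) • c d with hH
  have hCB : C * B = B * C := by simpa using hmul fun _ => 1
  have hHB : H * B = B * H - B * C := by
    rw [hH, hmul fun d => ((d : ℝ) : ℂ), hC, ← mul_sub, ← Finset.sum_sub_distrib]
    simp [sub_smul]
  have hCh : Cᴴ = C := by simpa using hherm fun _ => 1
  have hHh : Hᴴ = H := hherm fun d => d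
  have hCB' : C * Bᴴ = Bᴴ * C := by
    simpa [hCh] using (congrArg conjTranspose hCB).symm
  have hHB' : H * Bᴴ = Bᴴ * H + C * Bᴴ := by
    have := congrArg conjTranspose hHB
    simp only [conjTranspose_sub, conjTranspose_mul, hCh, hHh] at this
    rw [this]; abel
  have hCpos : C.PosDef := by
    have h0 : (0 : ℤ) ∈ T := by simp [hT]; omega
    rw [hC, ← Finset.add_sum_erase _ _ h0]
    exact ((hP 0).posDef_rowCompression (one_mem_wordSpan B)).add_posSemidef
      (posSemidef_sum _ fun d _ => (hP d).posSemidef_rowCompression)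
  have hu : IsUnit C.det := (Matrix.isUnit_iff_isUnit_det C).1 hCpos.isUnit
  have hinv : ∀ X, C * X = X * C → C⁻¹ * X = X * C⁻¹ := by
    intro X hX
    calc C⁻¹ * X = C⁻¹ * (X * C) * C⁻¹ := by
          rw [mul_assoc, mul_assoc, mul_nonsing_inv _ hu, mul_one]
      _ = X * C⁻¹ := by rw [← hX, ← mul_assoc, nonsing_inv_mul _ hu, one_mul]
  refine ⟨-(C⁻¹ * H), ?_, ?_⟩
  · have : B * (C⁻¹ * H) = C⁻¹ * (B * H) := by rw [← mul_assoc, ← hinv B hCB, mul_assoc]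
    rw [neg_mul, mul_neg, this, mul_assoc, hHB, ← hCB, mul_sub, ← mul_assoc C⁻¹ C,
      nonsing_inv_mul _ hu]
    simp
  · have : Bᴴ * (C⁻¹ * H) = C⁻¹ * (Bᴴ * H) := by rw [← mul_assoc, ← hinv _ hCB', mul_assoc]
    rw [neg_mul, mul_neg, this, mul_assoc, hHB', mul_add, ← mul_assoc C⁻¹ C,
      nonsing_inv_mul _ hu]
    simp

/-- `H` is not assumed Hermitian, but the adjoint of `h2` is `h1` for `Hᴴ`, so the Hermitian part of
`H` satisfies `h1` too. -/
theorem exists_skewAdjoint_of_commutator {n : ℕ} {B H : Matrix (Fin n) (Fin n) ℂ}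
    (h1 : H * B - B * H = B) (h2 : H * Bᴴ - Bᴴ * H = -Bᴴ) :
    ∃ K ∈ skewAdjoint (Matrix (Fin n) (Fin n) ℂ), K * B - B * K = -(Complex.I • B) := by
  have h3 : Hᴴ * B - B * Hᴴ = B := by
    have := congrArg conjTranspose h2
    simp only [conjTranspose_sub, conjTranspose_mul, conjTranspose_neg,
      conjTranspose_conjTranspose] at this
    rw [← neg_sub, this, neg_neg]
  refine ⟨(-Complex.I / 2) • (H + Hᴴ), ?_, ?_⟩
  · rw [skewAdjoint.mem_iff, star_eq_conjTranspose, conjTranspose_smul, conjTranspose_add,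
      conjTranspose_conjTranspose, ← neg_smul, add_comm]
    congr 1
    simp [neg_div]
  · have : (H + Hᴴ) * B - B * (H + Hᴴ) = (2 : ℂ) • B := by
      rw [add_mul, mul_add, add_sub_add_comm, h1, h3, two_smul]
    rw [smul_mul, Matrix.mul_smul, ← smul_sub, this, smul_smul, ← neg_smul]
    congr 1
    ring

/-! ### Gradings and block superdiagonal form -/

/-- In an eigenbasis of iK with eigenvalues λ, the relation reads (λ_i − λ_j − 1) b_ij = 0. -/
theorem exists_grading_of_skewAdjoint {n : ℕ} {B K : Matrix (Fin n) (Fin n) ℂ}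
    (hK : K ∈ skewAdjoint (Matrix (Fin n) (Fin n) ℂ)) (h : K * B - B * K = -(Complex.I • B)) :
    ∃ U ∈ Matrix.unitaryGroup (Fin n) ℂ, ∃ d : Fin n → ℤ,
      ∀ i j, (U * B * Uᴴ) i j ≠ 0 → d i = d j + 1 := by
  have hH : (Complex.I • K).IsHermitian := by
    rw [skewAdjoint.mem_iff, star_eq_conjTranspose] at hK
    rw [Matrix.IsHermitian, conjTranspose_smul, hK]
    simp
  set V : Matrix (Fin n) (Fin n) ℂ := (hH.eigenvectorUnitary : Matrix (Fin n) (Fin n) ℂ) with hV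
  have hVs : Vᴴ * V = 1 := Matrix.UnitaryGroup.star_mul_self hH.eigenvectorUnitary
  set D : Matrix (Fin n) (Fin n) ℂ := diagonal (RCLike.ofReal ∘ hH.eigenvalues) with hD
  have hspec : Complex.I • K = V * D * Vᴴ := by
    rw [hH.spectral_theorem, Unitary.conjStarAlgAut_apply]
    rfl
  have hcomm : Complex.I • K * B - B * (Complex.I • K) = B := by
    rw [smul_mul, Matrix.mul_smul, ← smul_sub, h, smul_neg, smul_smul]
    simp
  have hD' : D * (Vᴴ * B * V) - (Vᴴ * B * V) * D = Vᴴ * B * V := by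
    have e1 : D * (Vᴴ * B * V) = Vᴴ * (V * D * Vᴴ * B) * V := by
      simp only [← mul_assoc, hVs, one_mul]
    have e2 : Vᴴ * B * V * D = Vᴴ * (B * (V * D * Vᴴ)) * V := by
      simp only [mul_assoc, hVs, mul_one]
    rw [e1, e2, ← hspec, ← sub_mul, ← mul_sub, hcomm]
  refine ⟨Vᴴ, Unitary.star_mem hH.eigenvectorUnitary.2, fun i => ⌊hH.eigenvalues i⌋,
    fun i j hij => ?_⟩
  rw [conjTranspose_conjTranspose] at hij
  have he := congrFun (congrFun hD' i) j
  rw [Matrix.sub_apply, hD, diagonal_mul, mul_diagonal, mul_comm, ← mul_sub] at he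
  have he' := mul_left_cancel₀ hij (he.trans (mul_one _).symm)
  have : hH.eigenvalues i = hH.eigenvalues j + 1 := by
    have he2 : ((hH.eigenvalues i - hH.eigenvalues j : ℝ) : ℂ) = (1 : ℝ) := by
      simpa using he'
    have := Complex.ofReal_injective he2
    linarith
  simp only [this, Int.floor_add_one]

/-- The parts are the level sets of `d`, in decreasing order of degree. Two attained degrees that
differ by one are neighbours among the attained ones, whatever gaps occur elsewhere. -/
theorem exists_sorting_equiv {n : ℕ} (hn : 0 < n) (d : Fin n → ℤ) :
    ∃ (p : ℕ) (s : Fin p → ℕ) (e : (Σ k : Fin p, Fin (s k)) ≃ Fin n), 0 < p ∧ (∀ k, 0 < s k) ∧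
      ∀ x y, d (e x) = d (e y) + 1 → (y.1 : ℕ) = (x.1 : ℕ) + 1 := by
  classical
  set S : Finset ℤ := Finset.univ.image fun i => -d i with hS
  have hmem : ∀ i, -d i ∈ S := fun i => Finset.mem_image_of_mem _ (Finset.mem_univ i)
  set o : Fin S.card ≃o S := S.orderIsoOfFin rfl
  set g : Fin n → Fin S.card := fun i => o.symm ⟨-d i, hmem i⟩ with hg
  set e : (Σ k : Fin S.card, Fin (Fintype.card {i // g i = k})) ≃ Fin n :=
    (Equiv.sigmaCongrRight fun k => (Fintype.equivFin {i // g i = k}).symm).trans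
      (Equiv.sigmaFiberEquiv g) with he
  have hge : ∀ x, g (e x) = x.1 := fun x => ((Fintype.equivFin {i // g i = x.1}).symm x.2).2
  refine ⟨S.card, fun k => Fintype.card {i // g i = k}, e, Finset.card_pos.2 ⟨_, hmem ⟨0, hn⟩⟩,
    fun k => ?_, fun x y hxy => ?_⟩
  · obtain ⟨i, -, hi⟩ := Finset.mem_image.1 (o k).2
    refine Fintype.card_pos_iff.2 ⟨i, ?_⟩
    rw [hg, OrderIso.symm_apply_eq]
    exact Subtype.ext hi
  · have hcov : g (e x) ⋖ g (e y) := by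
      change o.symm _ ⋖ o.symm _
      rw [apply_covBy_apply_iff]
      refine ⟨Subtype.mk_lt_mk.2 (by omega), fun z h1 h2 => ?_⟩
      have h1' := Subtype.coe_lt_coe.2 h1
      have h2' := Subtype.coe_lt_coe.2 h2
      simp only at h1' h2'
      omega
    rw [hge, hge] at hcov
    by_contra hne
    have hlt : (x.1 : ℕ) < y.1 := hcov.1
    exact hcov.2 (c := ⟨x.1 + 1, by omega⟩) (Fin.lt_def.2 (Nat.lt_succ_self _))
      (Fin.lt_def.2 (by simp only; omega))

/-- One summand suffices, since superdiagonal blocks may vanish; for `n = 0` there is none, as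
summands must be nonempty. -/
theorem exists_isDirectSumOfBlockSuperdiagonal {n : ℕ} {B U : Matrix (Fin n) (Fin n) ℂ}
    (hU : U ∈ Matrix.unitaryGroup (Fin n) ℂ) (d : Fin n → ℤ)
    (hd : ∀ i j, (U * B * Uᴴ) i j ≠ 0 → d i = d j + 1) :
    ∃ U ∈ Matrix.unitaryGroup (Fin n) ℂ, IsDirectSumOfBlockSuperdiagonal (U * B * Uᴴ) := by
  rcases Nat.eq_zero_or_pos n with rfl | hn
  · exact ⟨1, one_mem _, 0, Fin.elim0, fun j => j.elim0, by simp, fun j => j.elim0,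
      fun j => j.elim0, fun j => j.elim0, fun j => j.elim0, Subsingleton.elim _ _⟩
  obtain ⟨p, s, e, hp, hs, he⟩ := exists_sorting_equiv hn d
  have hsum : ∑ _j : Fin 1, ∑ k, s k = n := by
    have := Fintype.card_congr e
    simpa using this
  set R := rowPosition (fun _ : Fin 1 => s) hsum
  let f : (Σ _ : Fin 1, Σ k : Fin p, Fin (s k)) ≃ Fin n :=
    (Equiv.uniqueSigma fun _ : Fin 1 => Σ k : Fin p, Fin (s k)).trans e
  set π : Fin n ≃ Fin n := R.symm.trans f
  have hconj : ∀ M : Matrix (Fin n) (Fin n) ℂ, U.submatrix π id * M * (U.submatrix π id)ᴴ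
      = (U * M * Uᴴ).submatrix π π := by
    intro M
    rfl
  refine ⟨U.submatrix π id, ?_, 1, fun _ => p, fun _ => s, hsum,
    fun _ => (U * B * Uᴴ).submatrix e e, fun _ => hp, fun _ => hs, ?_, ?_⟩
  · rw [Matrix.mem_unitaryGroup_iff] at hU ⊢
    have := hconj 1
    rw [mul_one, mul_one] at this
    rw [star_eq_conjTranspose, this, ← star_eq_conjTranspose, hU, submatrix_one_equiv]
  · intro _ k l hkl a b
    by_contra h0
    exact hkl (he ⟨k, a⟩ ⟨l, b⟩ (hd _ _ h0))
  · rw [hconj]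
    ext a b
    change (U * B * Uᴴ) (f (R.symm a)) (f (R.symm b)) =
      blockDiagonal' (fun _ : Fin 1 => (U * B * Uᴴ).submatrix e e) (R.symm a) (R.symm b)
    obtain ⟨i, x⟩ := R.symm a
    obtain ⟨j, y⟩ := R.symm b
    obtain rfl := Subsingleton.elim i 0
    obtain rfl := Subsingleton.elim j 0
    rw [blockDiagonal'_apply_eq]
    rfl

theorem IsDirectSumOfBlockSuperdiagonal.exists_grading {n : ℕ} {M : Matrix (Fin n) (Fin n) ℂ}
    (hM : IsDirectSumOfBlockSuperdiagonal M) :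
    ∃ d : Fin n → ℤ, ∀ i j, M i j ≠ 0 → d i = d j + 1 := by
  obtain ⟨r, p, s, h, C, -, -, hC, rfl⟩ := hM
  refine ⟨fun i => -(((rowPosition s h).symm i).2.1 : ℕ), fun i j hij => ?_⟩
  rw [reindex_apply, submatrix_apply] at hij
  beta_reduce
  generalize (rowPosition s h).symm i = u at hij ⊢
  generalize (rowPosition s h).symm j = v at hij ⊢
  obtain ⟨a, k, x⟩ := u
  obtain ⟨b, l, y⟩ := v
  obtain rfl : a = b := by
    by_contra hab
    exact hij (blockDiagonal'_apply_ne C _ _ hab)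
  rw [blockDiagonal'_apply_eq] at hij
  have : (l : ℕ) = k + 1 := by
    by_contra hkl
    exact hij (hC a k l hkl x y)
  simp only [this]
  push_cast
  ring

/-! ### Rotations and traces of words -/

theorem unitarilySimilar_exp_smul {n : ℕ} {B U : Matrix (Fin n) (Fin n) ℂ}
    (hU : U ∈ Matrix.unitaryGroup (Fin n) ℂ) (d : Fin n → ℤ)
    (hd : ∀ i j, (U * B * Uᴴ) i j ≠ 0 → d i = d j + 1) (t : ℝ) :
    UnitarilySimilar (Complex.exp (Complex.I * (t : ℂ)) • B) B := by
  have hU' : Uᴴ * U = 1 := Matrix.mem_unitaryGroup_iff'.1 hU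
  -- Conjugation by `W` multiplies entry (i, j) by e^{-it(d_i - d_j)}, which is e^{-it} wherever the
  -- entry is nonzero.
  set W : Matrix (Fin n) (Fin n) ℂ :=
    diagonal fun i => Complex.exp (-(Complex.I * t * d i)) with hW
  have hWs : Wᴴ = diagonal fun i => Complex.exp (Complex.I * t * d i) := by
    rw [hW, diagonal_conjTranspose]
    congr 1
    ext i
    simp [← Complex.exp_conj]
  have hWu : W ∈ Matrix.unitaryGroup (Fin n) ℂ := by
    rw [Matrix.mem_unitaryGroup_iff, star_eq_conjTranspose, hWs, hW, diagonal_mul_diagonal]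
    simp [← Complex.exp_add]
  have key : W * (Complex.exp (Complex.I * t) • (U * B * Uᴴ)) * Wᴴ = U * B * Uᴴ := by
    ext i j
    rw [hWs, hW, mul_diagonal, diagonal_mul, Matrix.smul_apply, smul_eq_mul]
    by_cases h0 : (U * B * Uᴴ) i j = 0
    · simp [h0]
    · have : Complex.exp (-(Complex.I * t * d i)) * Complex.exp (Complex.I * t) *
          Complex.exp (Complex.I * t * d j) = 1 := by
        rw [← Complex.exp_add, ← Complex.exp_add, hd i j h0, ← Complex.exp_zero]
        congr 1
        push_cast
        ring
      linear_combination ((U * B * Uᴴ) i j) * this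
  refine ⟨Uᴴ * W * U, mul_mem (mul_mem (Unitary.star_mem hU) hWu) hU, ?_⟩
  calc Uᴴ * W * U * (Complex.exp (Complex.I * t) • B) * (Uᴴ * W * U)ᴴ
      = Uᴴ * (W * (Complex.exp (Complex.I * t) • (U * B * Uᴴ)) * Wᴴ) * U := by
        simp only [conjTranspose_mul, conjTranspose_conjTranspose, smul_mul, Matrix.mul_smul,
          mul_assoc]
    _ = (Uᴴ * U) * B * (Uᴴ * U) := by rw [key]; simp only [mul_assoc]
    _ = B := by rw [hU', one_mul, mul_one]

theorem wordEval_smul {n : ℕ} (w : List Letter) (a b : ℂ) (X Y : Matrix (Fin n) (Fin n) ℂ) :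
    wordEval w (a • X) (b • Y)
      = (a ^ w.count Letter.P * b ^ w.count Letter.Q) • wordEval w X Y := by
  induction w with
  | nil => simp [wordEval]
  | cons c w ih =>
    rw [wordEval_cons, wordEval_cons, ih]
    cases c <;> simp [Letter.eval, smul_smul, pow_succ] <;> congr 1 <;> ring

theorem wordEval_conj {n : ℕ} (w : List Letter) {U : Matrix (Fin n) (Fin n) ℂ}
    (hU : U ∈ Matrix.unitaryGroup (Fin n) ℂ) (X Y : Matrix (Fin n) (Fin n) ℂ) :
    wordEval w (U * X * Uᴴ) (U * Y * Uᴴ) = U * wordEval w X Y * Uᴴ := by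
  have h1 : Uᴴ * U = 1 := Matrix.mem_unitaryGroup_iff'.1 hU
  have h2 : U * Uᴴ = 1 := Matrix.mem_unitaryGroup_iff.1 hU
  induction w with
  | nil => simp [wordEval, h2]
  | cons c w ih =>
    have hc : c.eval (U * X * Uᴴ) (U * Y * Uᴴ) = U * c.eval X Y * Uᴴ := by cases c <;> rfl
    rw [wordEval_cons, wordEval_cons, ih, hc]
    calc U * c.eval X Y * Uᴴ * (U * wordEval w X Y * Uᴴ)
        = U * c.eval X Y * (Uᴴ * U) * wordEval w X Y * Uᴴ := by simp only [mul_assoc]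
      _ = U * (c.eval X Y * wordEval w X Y) * Uᴴ := by rw [h1, mul_one]; simp only [mul_assoc]

theorem trace_wordEval_of_unitarilySimilar {n : ℕ} {X Y : Matrix (Fin n) (Fin n) ℂ}
    (h : UnitarilySimilar X Y) (w : List Letter) :
    (wordEval w X Xᴴ).trace = (wordEval w Y Yᴴ).trace := by
  obtain ⟨U, hU, rfl⟩ := h
  have h1 : Uᴴ * U = 1 := Matrix.mem_unitaryGroup_iff'.1 hU
  have h2 : (U * X * Uᴴ)ᴴ = U * Xᴴ * Uᴴ := by simp [conjTranspose_mul, mul_assoc]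
  rw [h2, wordEval_conj w hU, trace_mul_comm, ← mul_assoc, h1, one_mul]

theorem exists_exp_zpow_ne_one {m : ℤ} (hm : m ≠ 0) :
    ∃ t ∈ Set.Ico (0 : ℝ) (2 * Real.pi), Complex.exp (Complex.I * (t : ℂ)) ^ m ≠ 1 := by
  have hpos : (0 : ℝ) < |(m : ℝ)| := by positivity
  have h1 : (1 : ℝ) ≤ |(m : ℝ)| := by exact_mod_cast Int.one_le_abs hm
  -- At this `t` the power equals −1.
  refine ⟨Real.pi / |(m : ℝ)|, ⟨by positivity, ?_⟩, ?_⟩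
  · have := div_le_self Real.pi_pos.le h1
    linarith [Real.pi_pos]
  · rw [← Complex.exp_int_mul]
    have : Complex.exp (m * (Complex.I * ((Real.pi / |(m : ℝ)| : ℝ) : ℂ))) = -1 := by
      have hmC : (m : ℂ) ≠ 0 := by exact_mod_cast hm
      rcases lt_or_gt_of_ne hm with hneg | hpos'
      · rw [abs_of_neg (by exact_mod_cast hneg)]
        rw [show (m : ℂ) * (Complex.I * ((Real.pi / (-(m : ℝ)) : ℝ) : ℂ))
          = -(Real.pi * Complex.I) by push_cast; field_simp]
        rw [Complex.exp_neg, Complex.exp_pi_mul_I]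
        norm_num
      · rw [abs_of_pos (by exact_mod_cast hpos')]
        rw [show (m : ℂ) * (Complex.I * ((Real.pi / (m : ℝ) : ℝ) : ℂ))
          = Real.pi * Complex.I by push_cast; field_simp]
        exact Complex.exp_pi_mul_I
    rw [this]
    norm_num

theorem trace_wordEval_eq_zero {n : ℕ} {B : Matrix (Fin n) (Fin n) ℂ}
    (h : ∀ t ∈ Set.Ico (0 : ℝ) (2 * Real.pi),
      UnitarilySimilar (Complex.exp (Complex.I * (t : ℂ)) • B) B)
    (w : List Letter) (hw : w.count Letter.P ≠ w.count Letter.Q) :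
    (wordEval w B Bᴴ).trace = 0 := by
  obtain ⟨t, ht, hne⟩ := exists_exp_zpow_ne_one (m := wordDegree w)
    (by rw [wordDegree, sub_ne_zero]; exact_mod_cast hw)
  have he := trace_wordEval_of_unitarilySimilar (h t ht) w
  set z := Complex.exp (Complex.I * (t : ℂ)) with hz
  have hzs : star z = z⁻¹ := by
    rw [hz, ← Complex.exp_neg]
    simp [← Complex.exp_conj]
  have hz0 : z ≠ 0 := Complex.exp_ne_zero _
  rw [conjTranspose_smul, wordEval_smul, trace_smul, smul_eq_mul, hzs, inv_pow,
    ← div_eq_mul_inv, ← zpow_natCast, ← zpow_natCast, ← zpow_sub₀ hz0] at he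
  by_contra h0
  exact hne (mul_right_cancel₀ h0 (he.trans (one_mul _).symm))

theorem theorem3p1 (n : ℕ) (B : Matrix (Fin n) (Fin n) ℂ) :
    List.TFAE [
      ∀ t ∈ Set.Ico (0 : ℝ) (2 * Real.pi),
        UnitarilySimilar (Complex.exp (Complex.I * (t : ℂ)) • B) B,
      ∀ w : List Letter, w.count Letter.P ≠ w.count Letter.Q →
        (wordEval w B Bᴴ).trace = 0,
      ∃ K ∈ skewAdjoint (Matrix (Fin n) (Fin n) ℂ), K * B - B * K = -(Complex.I • B),
      ∃ U ∈ Matrix.unitaryGroup (Fin n) ℂ, IsDirectSumOfBlockSuperdiagonal (U * B * Uᴴ)] := by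
  tfae_have 1 → 2 := fun h => trace_wordEval_eq_zero h
  tfae_have 2 → 3 := fun h => by
    obtain ⟨H, h1, h2⟩ := exists_commutator_eq_of_trace_wordEval_eq_zero B h
    exact exists_skewAdjoint_of_commutator h1 h2
  tfae_have 3 → 4 := fun ⟨K, hK, h⟩ => by
    obtain ⟨U, hU, d, hd⟩ := exists_grading_of_skewAdjoint hK h
    exact exists_isDirectSumOfBlockSuperdiagonal hU d hd
  tfae_have 4 → 1 := fun ⟨U, hU, h⟩ t _ => by
    obtain ⟨d, hd⟩ := h.exists_grading
    exact unitarilySimilar_exp_smul hU d hd t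
  tfae_finish
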